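/- For a function $f\colon[0,1]\to[0,\infty)$ write $\int f:=\int_0^1 f(x)\,dx$, and let $\mathcal E$ be the set of all measurable decreasing (i.e. non-increasing) functions $f\colon[0,1]\to[0,\infty)$ with $f(0)=1$ and $\int f>0$. For $f\in\mathcal E$ let $f^*(y):=\sup\{x\in[0,1] : f(x)\ge y\}$ for $y\in[0,1]$ be its pseudo-inverse, and put \[ (Tf)(x):=\frac{\int_x^1 f^*(t)\,dt}{\int f}\qquad(x\in[0,1]). \] Let $h_0:=1$ be the constant function on $[0,1]$, and let $h_n:=T^n h_0$ and $\kappa_n:=\int h_n$ for all integers $n\ge 0$. Then all $h_n$ are well-defined elements of $\mathcal E$ (in particular $\kappa_n>0$), and $\kappa_n^2<\kappa_{n-1}\kappa_{n+1}$ holds for every $n\ge1$; equivalently, the sequence of ratios $\left(\frac{\kappa_n}{\kappa_{n-1}}\right)_{n\ge1}$ is strictly increasing. Moreover, $\lim_{n\to\infty}\frac{\kappa_n}{\kappa_{n-1}}=1$. -/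

import Mathlib

namespace Stribola

noncomputable section

/-- The area `∫₀¹ f` of a function on `[0,1]`. Functions on `[0,1]` are represented by functions
`ℝ → ℝ`, of which only the values on `[0,1]` are ever used. -/
def area (f : ℝ → ℝ) : ℝ := ∫ x in (0 : ℝ)..1, f x

/-- The decreasing measurable functions `f : [0,1] → [0,∞)` with `f 0 = 1` and positive area. -/
def classE : Set (ℝ → ℝ) :=
  {f | (∀ x ∈ Set.Icc (0 : ℝ) 1, 0 ≤ f x) ∧
    Measurable (fun x : Set.Icc (0 : ℝ) 1 => f x) ∧
    AntitoneOn f (Set.Icc 0 1) ∧ f 0 = 1 ∧ 0 < area f}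

/-- The pseudo-inverse `g^*(y) = sup {x ∈ [0,1] | g x ≥ y}` for `y ∈ [0,1]`. -/
def pseudoInv (g : ℝ → ℝ) (y : ℝ) : ℝ := sSup {x : ℝ | x ∈ Set.Icc (0 : ℝ) 1 ∧ y ≤ g x}

/-- The operator `(T f)(x) = (∫ₓ¹ f^*) / ∫₀¹ f` for `x ∈ [0,1]`. -/
def opT (f : ℝ → ℝ) (x : ℝ) : ℝ := (∫ t in x..1, pseudoInv f t) / area f

/-- The canonical stribolic iterates `h n = T^n 1`, where `1` is the constant function. -/
def h (n : ℕ) : ℝ → ℝ := opT^[n] (fun _ => 1)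

/-- The areas `κ n = ∫₀¹ h n`. -/
def kappa (n : ℕ) : ℝ := area (h n)

end

end Stribola

/-! By Fubini, `κ (n+1) / κ n = ½ ∫ (h n / κ n)²`, so the ratios increase as soon as the normalised
iterates have increasing `L²` norm. Two decreasing densities on `[0,1]` compare this way if they
cross once, the one with the larger norm starting above.

Single crossing alone does not pass through `T`, because inversion and normalisation rescale both
axes. The invariant is therefore stronger (`BelowIsInterval`): for all `l, m > 0`, the difference `f
x - l * g (m * x)` never shows the signs -, +, - in this order. Reflection in the diagonal preserves
this, and so does integration, by a Rolle argument with a check at the right endpoint. It holds for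
`(1 - x)²` against `1 - x` by convexity, hence for all consecutive iterates; injectivity of `T`
makes the comparison strict.

For the limit, areas bounded by 1 with increasing ratios must decrease. A uniform bound `1/16` from
below gives them a positive limit, so their ratios tend to 1. -/

namespace Stribola

open Set MeasureTheory

/-! ### Profiles and their inverses -/

/-- A strictly decreasing continuous bijection of `[0,1]` onto itself. -/
structure IsProfile (f : ℝ → ℝ) : Prop where
  cont : ContinuousOn f (Icc 0 1)
  anti : StrictAntiOn f (Icc 0 1)
  zero : f 0 = 1
  one : f 1 = 0

namespace IsProfile

variable {f : ℝ → ℝ}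

theorem mem (hf : IsProfile f) {x : ℝ} (hx : x ∈ Icc (0 : ℝ) 1) : f x ∈ Icc (0 : ℝ) 1 := by
  constructor
  · rw [← hf.one]
    exact hf.anti.antitoneOn hx (right_mem_Icc.2 zero_le_one) hx.2
  · rw [← hf.zero]
    exact hf.anti.antitoneOn (left_mem_Icc.2 zero_le_one) hx hx.1

theorem pos (hf : IsProfile f) {x : ℝ} (hx : x ∈ Ico (0 : ℝ) 1) : 0 < f x := by
  rw [← hf.one]
  exact hf.anti (Ico_subset_Icc_self hx) (right_mem_Icc.2 zero_le_one) hx.2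

theorem surj (hf : IsProfile f) {y : ℝ} (hy : y ∈ Icc (0 : ℝ) 1) :
    ∃ x ∈ Icc (0 : ℝ) 1, f x = y := by
  have := intermediate_value_Icc' zero_le_one hf.cont
  rw [hf.zero, hf.one] at this
  exact this hy

theorem pseudoInv_apply (hf : IsProfile f) {x : ℝ} (hx : x ∈ Icc (0 : ℝ) 1) :
    pseudoInv f (f x) = x := by
  have : {x' : ℝ | x' ∈ Icc (0 : ℝ) 1 ∧ f x ≤ f x'} = Icc 0 x := by
    ext x'
    constructor
    · rintro ⟨h1, h2⟩
      exact ⟨h1.1, (hf.anti.le_iff_ge hx h1).1 h2⟩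
    · rintro ⟨h1, h2⟩
      have h3 : x' ∈ Icc (0 : ℝ) 1 := ⟨h1, h2.trans hx.2⟩
      exact ⟨h3, (hf.anti.le_iff_ge hx h3).2 h2⟩
  rw [pseudoInv, this, csSup_Icc hx.1]

theorem pseudoInv_mem (hf : IsProfile f) {y : ℝ} (hy : y ∈ Icc (0 : ℝ) 1) :
    pseudoInv f y ∈ Icc (0 : ℝ) 1 := by
  obtain ⟨x, hx, rfl⟩ := hf.surj hy
  rwa [hf.pseudoInv_apply hx]

theorem apply_pseudoInv (hf : IsProfile f) {y : ℝ} (hy : y ∈ Icc (0 : ℝ) 1) :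
    f (pseudoInv f y) = y := by
  obtain ⟨x, hx, rfl⟩ := hf.surj hy
  rw [hf.pseudoInv_apply hx]

theorem le_pseudoInv_iff (hf : IsProfile f) {x y : ℝ} (hx : x ∈ Icc (0 : ℝ) 1)
    (hy : y ∈ Icc (0 : ℝ) 1) : x ≤ pseudoInv f y ↔ y ≤ f x := by
  obtain ⟨z, hz, rfl⟩ := hf.surj hy
  rw [hf.pseudoInv_apply hz, hf.anti.le_iff_ge hz hx]

theorem pseudoInv_lt_iff (hf : IsProfile f) {x y : ℝ} (hx : x ∈ Icc (0 : ℝ) 1)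
    (hy : y ∈ Icc (0 : ℝ) 1) : pseudoInv f y < x ↔ f x < y := by
  rw [← not_le, ← not_le, hf.le_pseudoInv_iff hx hy]

theorem lt_pseudoInv_iff (hf : IsProfile f) {x y : ℝ} (hx : x ∈ Icc (0 : ℝ) 1)
    (hy : y ∈ Icc (0 : ℝ) 1) : x < pseudoInv f y ↔ y < f x := by
  obtain ⟨z, hz, rfl⟩ := hf.surj hy
  rw [hf.pseudoInv_apply hz, hf.anti.lt_iff_gt hz hx]

/-- The inverse of a profile is a profile. -/
theorem isProfile_pseudoInv (hf : IsProfile f) : IsProfile (pseudoInv f) where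
  anti := by
    intro a ha b hb hab
    obtain ⟨x, hx, rfl⟩ := hf.surj ha
    rw [hf.pseudoInv_lt_iff (hf.pseudoInv_mem ha) hb, hf.pseudoInv_apply hx]
    exact hab
  zero := by
    rw [← hf.one]
    exact hf.pseudoInv_apply (right_mem_Icc.2 zero_le_one)
  one := by
    rw [← hf.zero]
    exact hf.pseudoInv_apply (left_mem_Icc.2 zero_le_one)
  cont := by
    -- Continuity comes for free: a monotone surjection of `[0,1]` onto itself is continuous. The
    -- flip `1 - ·` turns antitone into monotone.
    let φ : Icc (0 : ℝ) 1 → Icc (0 : ℝ) 1 := fun y =>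
      ⟨1 - pseudoInv f y, by linarith [(hf.pseudoInv_mem y.2).2],
        by linarith [(hf.pseudoInv_mem y.2).1]⟩
    have hφ : Continuous φ := by
      apply Monotone.continuous_of_surjective
      · intro a b hab
        change 1 - pseudoInv f a ≤ 1 - pseudoInv f b
        have := (hf.le_pseudoInv_iff (hf.pseudoInv_mem b.2) a.2).2
          (by rw [hf.apply_pseudoInv b.2]; exact hab)
        linarith
      · intro z
        have hz : 1 - (z : ℝ) ∈ Icc (0 : ℝ) 1 := ⟨by linarith [z.2.2], by linarith [z.2.1]⟩
        refine ⟨⟨f (1 - z), hf.mem hz⟩, Subtype.ext ?_⟩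
        change 1 - pseudoInv f (f (1 - z)) = z
        rw [hf.pseudoInv_apply hz]
        ring
    rw [continuousOn_iff_continuous_domRestrict]
    have h : (Icc (0 : ℝ) 1).domRestrict (pseudoInv f) = fun y => 1 - (φ y : ℝ) := by
      ext y
      simp [φ]
    rw [h]
    fun_prop

theorem intervalIntegrable (hf : IsProfile f) {a b : ℝ} (ha : a ∈ Icc (0 : ℝ) 1)
    (hb : b ∈ Icc (0 : ℝ) 1) : IntervalIntegrable f volume a b :=
  (hf.cont.mono (uIcc_subset_Icc ha hb)).intervalIntegrable

theorem area_pos (hf : IsProfile f) : 0 < area f :=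
  intervalIntegral.intervalIntegral_pos_of_pos_on
    (hf.intervalIntegrable (left_mem_Icc.2 zero_le_one) (right_mem_Icc.2 zero_le_one))
    (fun _ hx => hf.pos ⟨hx.1.le, hx.2⟩) zero_lt_one

theorem area_le_one (hf : IsProfile f) : area f ≤ 1 := by
  have := intervalIntegral.integral_mono_on zero_le_one
    (hf.intervalIntegrable (left_mem_Icc.2 zero_le_one) (right_mem_Icc.2 zero_le_one))
    (intervalIntegrable_const (c := (1 : ℝ))) (fun x hx => (hf.mem hx).2)
  simpa [area] using this

theorem mem_classE (hf : IsProfile f) : f ∈ classE :=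
  ⟨fun _ hx => (hf.mem hx).1, (continuousOn_iff_continuous_domRestrict.1 hf.cont).measurable,
    hf.anti.antitoneOn, hf.zero, hf.area_pos⟩

end IsProfile

/-! ### Fubini on the unit square and area identities -/

theorem integral_unitSquare_swap {F : ℝ → ℝ → ℝ} (hF : Measurable (Function.uncurry F)) {C : ℝ}
    (hC : ∀ x ∈ Icc (0 : ℝ) 1, ∀ y ∈ Icc (0 : ℝ) 1, |F x y| ≤ C) :
    ∫ x in (0 : ℝ)..1, ∫ y in (0 : ℝ)..1, F x y = ∫ y in (0 : ℝ)..1, ∫ x in (0 : ℝ)..1, F x y := by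
  simp only [intervalIntegral.integral_of_le zero_le_one]
  apply integral_integral_swap
  apply Integrable.of_bound hF.aestronglyMeasurable C
  rw [Measure.prod_restrict]
  refine (ae_restrict_iff' (measurableSet_Ioc.prod measurableSet_Ioc)).2 (ae_of_all _ ?_)
  rintro ⟨x, y⟩ ⟨hx, hy⟩
  exact hC x (Ioc_subset_Icc_self hx) y (Ioc_subset_Icc_self hy)

theorem integral_step {a c : ℝ} (ha : a ∈ Icc (0 : ℝ) 1) (hc : c ∈ Icc (0 : ℝ) 1) :
    ∫ t in (0 : ℝ)..1, (if a < t ∧ t ≤ c then (1 : ℝ) else 0) = max (c - a) 0 := by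
  rw [intervalIntegral.integral_of_le zero_le_one]
  have h : (fun t : ℝ => if a < t ∧ t ≤ c then (1 : ℝ) else 0) = (Ioc a c).indicator 1 := by
    ext t
    simp [indicator, mem_Ioc]
  rw [h, integral_indicator_one measurableSet_Ioc, measureReal_restrict_apply measurableSet_Ioc,
    inter_eq_left.2 (Ioc_subset_Ioc ha.1 hc.2), Real.volume_real_Ioc]

theorem integral_posPart_sub {c : ℝ} (hc : c ∈ Icc (0 : ℝ) 1) :
    ∫ x in (0 : ℝ)..1, max (c - x) 0 = c ^ 2 / 2 := by
  have hi : ∀ a b : ℝ, IntervalIntegrable (fun x => max (c - x) 0) volume a b := fun a b =>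
    Continuous.intervalIntegrable (by fun_prop) a b
  rw [← intervalIntegral.integral_add_adjacent_intervals (hi 0 c) (hi c 1)]
  have h1 : ∫ x in (0 : ℝ)..c, max (c - x) 0 = ∫ x in (0 : ℝ)..c, (c - x) := by
    apply intervalIntegral.integral_congr
    intro x hx
    rw [uIcc_of_le hc.1] at hx
    simpa using hx.2
  have h2 : ∫ x in c..(1 : ℝ), max (c - x) 0 = ∫ x in c..(1 : ℝ), (0 : ℝ) := by
    apply intervalIntegral.integral_congr
    intro x hx
    rw [uIcc_of_le hc.2] at hx
    simpa using hx.1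
  rw [h1, h2, intervalIntegral.integral_sub intervalIntegrable_const intervalIntegral.intervalIntegrable_id]
  simp
  ring

namespace IsProfile

variable {f : ℝ → ℝ}

theorem measurable_extend (hf : IsProfile f) :
    Measurable (IccExtend (zero_le_one' ℝ) ((Icc (0 : ℝ) 1).domRestrict f)) :=
  (continuousOn_iff_continuous_domRestrict.1 hf.cont).Icc_extend'.measurable

/-- The area under the inverse to the right of `x` is the area of the graph above height `x`. -/
theorem integral_pseudoInv (hf : IsProfile f) {x : ℝ} (hx : x ∈ Icc (0 : ℝ) 1) :
    ∫ t in x..1, pseudoInv f t = ∫ s in (0 : ℝ)..1, max (f s - x) 0 := by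
  -- The constant extension of `f` beyond `[0,1]` is measurable on all of `ℝ`; Fubini is applied to
  -- the region `x < t ≤ e s`.
  set e := IccExtend (zero_le_one' ℝ) ((Icc (0 : ℝ) 1).domRestrict f) with he
  have hef : ∀ s ∈ Icc (0 : ℝ) 1, e s = f s := fun s hs => IccExtend_of_mem _ _ hs
  have hswap := integral_unitSquare_swap
    (F := fun t s => if x < t ∧ t ≤ e s then (1 : ℝ) else 0) (C := 1)
    (by
      refine Measurable.ite ?_ measurable_const measurable_const
      exact (measurableSet_lt measurable_const measurable_fst).inter
        (measurableSet_le measurable_fst (hf.measurable_extend.comp measurable_snd)))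
    (by intro t _ s _; split_ifs <;> simp)
  have hR : ∫ s in (0 : ℝ)..1, ∫ t in (0 : ℝ)..1, (if x < t ∧ t ≤ e s then (1 : ℝ) else 0)
      = ∫ s in (0 : ℝ)..1, max (f s - x) 0 := by
    apply intervalIntegral.integral_congr
    intro s hs
    rw [uIcc_of_le zero_le_one] at hs
    simp only [hef s hs]
    exact integral_step hx (hf.mem hs)
  have hI : ∀ t ∈ Icc (0 : ℝ) 1,
      ∫ s in (0 : ℝ)..1, (if x < t ∧ t ≤ e s then (1 : ℝ) else 0)
        = if x < t then pseudoInv f t else 0 := by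
    intro t ht
    split_ifs with hxt
    · have hg := hf.pseudoInv_mem ht
      calc _ = ∫ s in (0 : ℝ)..1, (if 0 < s ∧ s ≤ pseudoInv f t then (1 : ℝ) else 0) := by
            rw [intervalIntegral.integral_of_le zero_le_one,
              intervalIntegral.integral_of_le zero_le_one]
            apply setIntegral_congr_fun measurableSet_Ioc
            intro s hs
            have hs' := Ioc_subset_Icc_self hs
            simp only [hxt, true_and, hef s hs', hs.1, hf.le_pseudoInv_iff hs' ht]
        _ = max (pseudoInv f t - 0) 0 := integral_step (left_mem_Icc.2 zero_le_one) hg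
        _ = pseudoInv f t := by rw [sub_zero, max_eq_left hg.1]
    · simp [hxt]
  have hL : ∫ t in (0 : ℝ)..1, ∫ s in (0 : ℝ)..1, (if x < t ∧ t ≤ e s then (1 : ℝ) else 0)
      = ∫ t in x..1, pseudoInv f t := by
    rw [intervalIntegral.integral_congr (g := fun t => if x < t then pseudoInv f t else 0)
      (fun t ht => hI t (by rwa [uIcc_of_le zero_le_one] at ht)),
      intervalIntegral.integral_of_le zero_le_one, intervalIntegral.integral_of_le hx.2]
    have h : (fun t => if x < t then pseudoInv f t else 0) = (Ioi x).indicator (pseudoInv f) := by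
      ext t
      simp [indicator, mem_Ioi]
    rw [h, setIntegral_indicator measurableSet_Ioi, Ioc_inter_Ioi, max_eq_right hx.1]
  rw [← hL, hswap, hR]

theorem area_pseudoInv (hf : IsProfile f) : area (pseudoInv f) = area f := by
  rw [area, hf.integral_pseudoInv (left_mem_Icc.2 zero_le_one)]
  apply intervalIntegral.integral_congr
  intro s hs
  rw [uIcc_of_le zero_le_one] at hs
  simpa using (hf.mem hs).1

/-- The image of a profile under the operator `T` is a profile. -/
theorem isProfile_opT (hf : IsProfile f) : IsProfile (opT f) where
  cont := by
    have hg := hf.isProfile_pseudoInv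
    have h := intervalIntegral.continuousOn_primitive_interval_left (a := (0 : ℝ)) (b := 1)
      (f := pseudoInv f) (μ := volume)
      (by rw [uIcc_of_le zero_le_one]; exact hg.cont.integrableOn_Icc)
    rw [uIcc_of_le zero_le_one] at h
    exact h.div_const _
  anti := by
    intro a ha b hb hab
    have hg := hf.isProfile_pseudoInv
    have h1 : (1 : ℝ) ∈ Icc (0 : ℝ) 1 := right_mem_Icc.2 zero_le_one
    have hp : 0 < ∫ t in a..b, pseudoInv f t :=
      intervalIntegral.intervalIntegral_pos_of_pos_on (hg.intervalIntegrable ha hb)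
        (fun x hx => hg.pos ⟨ha.1.trans hx.1.le, hx.2.trans_le hb.2⟩) hab
    have := intervalIntegral.integral_add_adjacent_intervals (hg.intervalIntegrable ha hb)
      (hg.intervalIntegrable hb h1)
    exact div_lt_div_of_pos_right (by linarith) hf.area_pos
  zero := by
    have := hf.area_pseudoInv
    rw [area] at this
    rw [opT, this, div_self hf.area_pos.ne']
  one := by simp [opT]

theorem opT_sub (hf : IsProfile f) {a b : ℝ} (ha : a ∈ Icc (0 : ℝ) 1) (hb : b ∈ Icc (0 : ℝ) 1) :
    opT f a - opT f b = (∫ t in a..b, pseudoInv f t) / area f := by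
  have hg := hf.isProfile_pseudoInv
  have h1 : (1 : ℝ) ∈ Icc (0 : ℝ) 1 := right_mem_Icc.2 zero_le_one
  rw [opT, opT, ← intervalIntegral.integral_add_adjacent_intervals (hg.intervalIntegrable ha hb)
      (hg.intervalIntegrable hb h1)]
  ring

/-- Integrate `∫ₓ¹ f^* = ∫ (f s - x)⁺ ds` over `x` and swap: the inner integral is `f s ^ 2 / 2`.
This turns ratios of areas into `L²` norms. -/
theorem area_opT_mul_area (hf : IsProfile f) :
    area (opT f) * area f = (∫ s in (0 : ℝ)..1, f s ^ 2) / 2 := by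
  set e := IccExtend (zero_le_one' ℝ) ((Icc (0 : ℝ) 1).domRestrict f) with he
  have hef : ∀ s ∈ Icc (0 : ℝ) 1, e s = f s := fun s hs => IccExtend_of_mem _ _ hs
  have hswap := integral_unitSquare_swap (F := fun x s => max (e s - x) 0) (C := 1)
    (((hf.measurable_extend.comp measurable_snd).sub measurable_fst).max measurable_const)
    (by
      intro x hx s hs
      rw [hef s hs, abs_of_nonneg (le_max_right _ _)]
      exact max_le (by linarith [(hf.mem hs).2, hx.1]) zero_le_one)
  have hR : ∫ s in (0 : ℝ)..1, ∫ x in (0 : ℝ)..1, max (e s - x) 0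
      = (∫ s in (0 : ℝ)..1, f s ^ 2) / 2 := by
    rw [← intervalIntegral.integral_div]
    apply intervalIntegral.integral_congr
    intro s hs
    rw [uIcc_of_le zero_le_one] at hs
    simp only [hef s hs]
    exact integral_posPart_sub (hf.mem hs)
  rw [← hR, ← hswap, area, ← intervalIntegral.integral_mul_const]
  apply intervalIntegral.integral_congr
  intro x hx
  rw [uIcc_of_le zero_le_one] at hx
  simp only [opT]
  rw [div_mul_cancel₀ _ hf.area_pos.ne', hf.integral_pseudoInv hx]
  apply intervalIntegral.integral_congr
  intro s hs
  rw [uIcc_of_le zero_le_one] at hs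
  simp only [hef s hs]

end IsProfile

/-! ### The crossing property and its invariance under `T` -/

/-- The graph of `f` meets the rescaled graph `x ↦ l * g (m * x)` in such a way that the set where
`f` lies below it is an interval, up to points of equality. -/
def BelowIsInterval (f g : ℝ → ℝ) : Prop :=
  ∀ l m x y z : ℝ, 0 < l → 0 < m → 0 ≤ x → x < y → y < z → z ≤ 1 → m * z ≤ 1 →
    f x < l * g (m * x) → l * g (m * y) < f y → l * g (m * z) ≤ f z

theorem exists_neg_of_integral_neg {F : ℝ → ℝ} {a b : ℝ} (hab : a ≤ b)
    (h : ∫ t in a..b, F t < 0) : ∃ t ∈ Icc a b, F t < 0 := by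
  by_contra! hF
  exact h.not_ge (intervalIntegral.integral_nonneg hab hF)

theorem exists_pos_of_integral_pos {F : ℝ → ℝ} {a b : ℝ} (hab : a ≤ b)
    (h : 0 < ∫ t in a..b, F t) : ∃ t ∈ Icc a b, 0 < F t := by
  by_contra! hF
  have := intervalIntegral.integral_nonneg (f := fun t => -F t) (μ := volume) hab
    (fun u hu => neg_nonneg.2 (hF u hu))
  rw [intervalIntegral.integral_neg] at this
  linarith

section

variable {f g : ℝ → ℝ}

/-- Reflecting graphs in the diagonal transfers `BelowIsInterval` to the inverse functions. -/
theorem BelowIsInterval.map_pseudoInv (hfg : BelowIsInterval f g) (hf : IsProfile f)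
    (hg : IsProfile g) : BelowIsInterval (pseudoInv f) (pseudoInv g) := by
  intro A m x y z hA hm hx hxy hyz hz hmz h1 h2
  by_contra! h3
  have hx' : x ∈ Icc (0 : ℝ) 1 := ⟨hx, by linarith⟩
  have hy' : y ∈ Icc (0 : ℝ) 1 := ⟨by linarith, by linarith⟩
  have hz' : z ∈ Icc (0 : ℝ) 1 := ⟨by linarith, hz⟩
  have hxm : m * x ∈ Icc (0 : ℝ) 1 := ⟨mul_nonneg hm.le hx'.1, by nlinarith⟩
  have hym : m * y ∈ Icc (0 : ℝ) 1 := ⟨mul_nonneg hm.le hy'.1, by nlinarith⟩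
  have hzm : m * z ∈ Icc (0 : ℝ) 1 := ⟨mul_nonneg hm.le hz'.1, hmz⟩
  have hF := hf.isProfile_pseudoInv
  have hxF := hf.pseudoInv_mem hx'
  have hyF := hf.pseudoInv_mem hy'
  have hzF := hf.pseudoInv_mem hz'
  have hyx := hF.anti hx' hy' hxy
  have hzy := hF.anti hy' hz' hyz
  have ex := hf.apply_pseudoInv hx'
  have ey := hf.apply_pseudoInv hy'
  have ez := hf.apply_pseudoInv hz'
  generalize pseudoInv f x = X at *
  generalize pseudoInv f y = Y at *
  generalize pseudoInv f z = Z at *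
  have h1' : A⁻¹ * X < pseudoInv g (m * x) := by rwa [inv_mul_lt_iff₀ hA]
  have h2' : pseudoInv g (m * y) < A⁻¹ * Y := by rwa [lt_inv_mul_iff₀ hA]
  have h3' : A⁻¹ * Z < pseudoInv g (m * z) := by rwa [inv_mul_lt_iff₀ hA]
  have hAi : 0 < A⁻¹ := inv_pos.2 hA
  have hX1 : A⁻¹ * X ≤ 1 := h1'.le.trans (hg.pseudoInv_mem hxm).2
  have hXm : A⁻¹ * X ∈ Icc (0 : ℝ) 1 := ⟨mul_nonneg hAi.le hxF.1, hX1⟩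
  have hYm : A⁻¹ * Y ∈ Icc (0 : ℝ) 1 := ⟨mul_nonneg hAi.le hyF.1, by nlinarith⟩
  have hZm : A⁻¹ * Z ∈ Icc (0 : ℝ) 1 := ⟨mul_nonneg hAi.le hzF.1, by nlinarith⟩
  rw [hg.lt_pseudoInv_iff hXm hxm] at h1'
  rw [hg.pseudoInv_lt_iff hYm hym] at h2'
  rw [hg.lt_pseudoInv_iff hZm hzm] at h3'
  -- Both functions decrease, so reflection keeps "below" as "below" and reverses the order of the
  -- points; the two scale factors become `m⁻¹` and `A⁻¹`.
  have := hfg m⁻¹ A⁻¹ Z Y X (inv_pos.2 hm) hAi hzF.1 hzy hyx hxF.2 hX1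
    (by rwa [ez, lt_inv_mul_iff₀ hm]) (by rwa [ey, inv_mul_lt_iff₀ hm])
  rw [ex, inv_mul_le_iff₀ hm] at this
  linarith

/-- The property `BelowIsInterval` is preserved by the operator `T`. -/
theorem BelowIsInterval.map_opT (hfg : BelowIsInterval f g) (hf : IsProfile f)
    (hg : IsProfile g) : BelowIsInterval (opT f) (opT g) := by
  intro l m x y z hl hm hx hxy hyz hz hmz h1 h2
  by_contra! h3
  have hF := hf.isProfile_pseudoInv
  have hG := hg.isProfile_pseudoInv
  have hκ := hf.area_pos
  have hκ' := hg.area_pos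
  -- With this factor, `pseudoInv f t - A * pseudoInv g (m * t)` is `-area f` times the derivative
  -- of `opT f t - l * opT g (m * t)`.
  set A := l * m * (area f / area g) with hAdef
  have hA : 0 < A := by positivity
  have hdom : ∀ t, 0 ≤ t → m * t ≤ 1 → m * t ∈ Icc (0 : ℝ) 1 := fun t h0 h1 =>
    ⟨mul_nonneg hm.le h0, h1⟩
  have key : ∀ a b : ℝ, 0 ≤ a → a ≤ b → b ≤ 1 → m * b ≤ 1 →
      ∫ t in a..b, (pseudoInv f t - A * pseudoInv g (m * t)) =
        area f * ((opT f a - l * opT g (m * a)) -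
          (opT f b - l * opT g (m * b))) := by
    intro a b ha hab hb hmb
    have hma : m * a ≤ 1 := (mul_le_mul_of_nonneg_left hab hm.le).trans hmb
    have ha' : a ∈ Icc (0 : ℝ) 1 := ⟨ha, hab.trans hb⟩
    have hb' : b ∈ Icc (0 : ℝ) 1 := ⟨ha.trans hab, hb⟩
    have e1 := hf.opT_sub ha' hb'
    have e2 := hg.opT_sub (hdom a ha hma) (hdom b hb'.1 hmb)
    have hint : IntervalIntegrable (fun t => pseudoInv g (m * t)) volume a b := by
      apply ContinuousOn.intervalIntegrable
      rw [uIcc_of_le hab]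
      refine hG.cont.comp (by fun_prop) fun t ht => hdom t (ha.trans ht.1) ?_
      exact (mul_le_mul_of_nonneg_left ht.2 hm.le).trans hmb
    rw [intervalIntegral.integral_sub (hF.intervalIntegrable ha' hb') (hint.const_mul A),
      intervalIntegral.integral_const_mul,
      intervalIntegral.integral_comp_mul_left (fun t => pseudoInv g t) hm.ne', smul_eq_mul]
    rw [eq_div_iff hκ.ne'] at e1
    rw [eq_div_iff hκ'.ne'] at e2
    rw [← e1, ← e2, hAdef]
    field_simp
    ring
  have hmy : m * y ≤ 1 := (mul_le_mul_of_nonneg_left hyz.le hm.le).trans hmz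
  obtain ⟨ξ, hξ, hξE⟩ := exists_neg_of_integral_neg hxy.le
    (F := fun t => pseudoInv f t - A * pseudoInv g (m * t))
    (by rw [key x y hx hxy.le (hyz.le.trans hz) hmy]
        exact mul_neg_of_pos_of_neg hκ (by linarith))
  obtain ⟨η, hη, hηE⟩ := exists_pos_of_integral_pos hyz.le
    (F := fun t => pseudoInv f t - A * pseudoInv g (m * t))
    (by rw [key y z (hx.trans hxy.le) hyz.le hz hmz]
        exact mul_pos hκ (by linarith))
  -- The third sign comes from the right end of the common domain. If `m < 1`, the integrand is
  -- negative at 1. If `m ≥ 1`, the difference of the `opT`s rises from a negative value at `z` to a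
  -- nonnegative one at `m⁻¹`.
  obtain ⟨ζ, hζη, hζ1, hmζ, hζE⟩ : ∃ ζ, η ≤ ζ ∧ ζ ≤ 1 ∧ m * ζ ≤ 1 ∧
      pseudoInv f ζ - A * pseudoInv g (m * ζ) < 0 := by
    rcases lt_or_ge m 1 with hm1 | hm1
    · refine ⟨1, hη.2.trans hz, le_rfl, by linarith, ?_⟩
      rw [hF.one, zero_sub, neg_lt_zero, mul_one]
      exact mul_pos hA (hG.pos ⟨hm.le, hm1⟩)
    · have hw : m⁻¹ ≤ 1 := inv_le_one_of_one_le₀ hm1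
      have hmw : m * m⁻¹ = 1 := mul_inv_cancel₀ hm.ne'
      have hzw : z ≤ m⁻¹ := by rwa [← mul_le_mul_iff_right₀ hm, hmw]
      have hnn := (hf.isProfile_opT.mem ⟨(inv_pos.2 hm).le, hw⟩).1
      obtain ⟨ζ, hζ, hζE⟩ := exists_neg_of_integral_neg hzw
        (F := fun t => pseudoInv f t - A * pseudoInv g (m * t))
        (by rw [key z m⁻¹ (by linarith) hzw hw hmw.le, hmw, hg.isProfile_opT.one]
            exact mul_neg_of_pos_of_neg hκ (by linarith))
      refine ⟨ζ, hη.2.trans hζ.1, hζ.2.trans hw, ?_, hζE⟩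
      rw [← hmw]
      exact mul_le_mul_of_nonneg_left hζ.2 hm.le
  have hξη : ξ < η := by
    refine lt_of_le_of_ne (hξ.2.trans hη.1) ?_
    rintro rfl
    exact hξE.not_gt hηE
  have hηζ : η < ζ := by
    refine lt_of_le_of_ne hζη ?_
    rintro rfl
    exact hζE.not_gt hηE
  have := hfg.map_pseudoInv hf hg A m ξ η ζ hA hm (hx.trans hξ.1) hξη hηζ hζ1 hmζ
    (by linarith) (by linarith)
  linarith

/-- Without rescaling the argument, `f` crosses each multiple of `g` only from above to below. -/
theorem BelowIsInterval.le_of_lt (hfg : BelowIsInterval f g) (hf : IsProfile f)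
    (hg : IsProfile g) {l x y : ℝ} (hl : 0 < l) (hx : 0 ≤ x) (hxy : x < y) (hy : y ≤ 1)
    (h : f x < l * g x) : f y ≤ l * g y := by
  by_contra! hlt
  have hy1 : y < 1 := by
    refine lt_of_le_of_ne hy ?_
    rintro rfl
    rw [hf.one, hg.one, mul_zero] at hlt
    exact hlt.false
  have hlim : ∀ t ∈ Icc (0 : ℝ) 1,
      Filter.Tendsto (fun m : ℝ => l * g (m * t)) (nhdsWithin 1 (Ioo 0 1)) (nhds (l * g t)) := by
    intro t ht
    have hc : ContinuousWithinAt (fun m : ℝ => l * g (m * t)) (Ioo 0 1) 1 := by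
      apply ContinuousWithinAt.const_mul
      refine ContinuousWithinAt.comp (t := Icc 0 1) ?_ (by fun_prop) ?_
      · rw [one_mul]
        exact hg.cont t ht
      · exact fun m hm => ⟨mul_nonneg hm.1.le ht.1, mul_le_one₀ hm.2.le ht.1 ht.2⟩
    simpa [ContinuousWithinAt] using hc
  have hne : (nhdsWithin (1 : ℝ) (Ioo 0 1)).NeBot :=
    right_nhdsWithin_Ioo_neBot zero_lt_one
  obtain ⟨m, ⟨hm1, hm2⟩, hm⟩ :=
    (((hlim x ⟨hx, by linarith⟩).eventually (lt_mem_nhds h)).and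
      ((hlim y ⟨by linarith, hy⟩).eventually (gt_mem_nhds hlt))).and
        self_mem_nhdsWithin |>.exists
  have := hfg l m x y 1 hl hm.1 hx hxy hy1 le_rfl (by linarith [hm.2]) hm1 hm2
  rw [hf.one, mul_one] at this
  have hp := mul_pos hl (hg.pos ⟨hm.1.le, hm.2⟩)
  linarith

/-! ### Strict comparison of ratios -/

/-- Since `D` has mean zero, `s` may be replaced by `s - s p`, where `p` is the point at which `D`
changes sign. Then both factors change sign together and the integrand is nonnegative. -/
theorem integral_pos_of_crossing {D s : ℝ → ℝ} (hD : ContinuousOn D (Icc 0 1))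
    (hs : ContinuousOn s (Icc 0 1)) (hs' : StrictAntiOn s (Icc 0 1))
    (hcross : ∀ x y, 0 ≤ x → x < y → y ≤ 1 → D x < 0 → D y ≤ 0)
    (h0 : ∫ x in (0 : ℝ)..1, D x = 0) (hne : ∃ x ∈ Icc (0 : ℝ) 1, D x ≠ 0) :
    0 < ∫ x in (0 : ℝ)..1, D x * s x := by
  -- Inserting 1 keeps the infimum meaningful when `D` is never negative.
  set N := insert 1 {x | x ∈ Icc (0 : ℝ) 1 ∧ D x < 0} with hN
  have hNs : N ⊆ Icc 0 1 :=
    insert_subset (right_mem_Icc.2 zero_le_one) fun x hx => hx.1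
  have hNne : N.Nonempty := ⟨1, mem_insert _ _⟩
  have hbdd : BddBelow N := ⟨0, fun x hx => (hNs hx).1⟩
  set p := sInf N with hp
  have hpm : p ∈ Icc (0 : ℝ) 1 :=
    ⟨le_csInf hNne fun x hx => (hNs hx).1, csInf_le hbdd (mem_insert _ _)⟩
  have hleft : ∀ x, 0 ≤ x → x < p → 0 ≤ D x := by
    intro x hx hxp
    by_contra! hneg
    exact hxp.not_ge (csInf_le hbdd (mem_insert_of_mem _ ⟨⟨hx, by linarith [hpm.2]⟩, hneg⟩))
  have hright : ∀ x, p < x → x ≤ 1 → D x ≤ 0 := by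
    intro x hpx hx
    obtain ⟨n, hn, hnx⟩ := exists_lt_of_csInf_lt hNne hpx
    rcases hn with rfl | hn
    · linarith
    · exact hcross n x hn.1.1 hnx hx hn.2
  have hsplit : ∫ x in (0 : ℝ)..1, D x * (s x - s p) = ∫ x in (0 : ℝ)..1, D x * s x := by
    have e : ∀ x, D x * (s x - s p) = D x * s x - D x * s p := fun x => by ring
    simp only [e]
    rw [intervalIntegral.integral_sub, intervalIntegral.integral_mul_const, h0, zero_mul, sub_zero]
    · exact ContinuousOn.intervalIntegrable (by rw [uIcc_of_le zero_le_one]; exact hD.mul hs)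
    · exact ContinuousOn.intervalIntegrable
        (by rw [uIcc_of_le zero_le_one]; exact hD.mul continuousOn_const)
  rw [← hsplit]
  apply intervalIntegral.integral_pos (f := fun x => D x * (s x - s p)) zero_lt_one
    (hD.mul (hs.sub continuousOn_const))
  · intro x hx
    have hx' := Ioc_subset_Icc_self hx
    rcases lt_trichotomy x p with h | rfl | h
    · exact mul_nonneg (hleft x hx'.1 h) (by linarith [hs' hx' hpm h])
    · simp
    · exact mul_nonneg_of_nonpos_of_nonpos (hright x h hx'.2)
        (by linarith [hs' hpm hx' h])
  · by_contra! hall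
    have hz : ∀ x ∈ Icc (0 : ℝ) 1, x ≠ p → D x = 0 := by
      intro x hx hxp
      have := hall x hx
      rcases lt_or_gt_of_ne hxp with h | h
      · have h1 := hleft x hx.1 h
        have h2 := hs' hx hpm h
        nlinarith
      · have h1 := hright x h hx.2
        have h2 := hs' hpm hx h
        nlinarith
    have hDp : D p ≠ 0 := by
      obtain ⟨x, hx, hxD⟩ := hne
      by_cases hxp : x = p
      · rwa [← hxp]
      · exact absurd (hz x hx hxp) hxD
    rcases lt_or_gt_of_ne hDp with h | h
    · have := intervalIntegral.integral_pos zero_lt_one hD.neg (fun x hx => by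
        by_cases hxp : x = p
        · rw [hxp]; simpa using h.le
        · simp [hz x (Ioc_subset_Icc_self hx) hxp]) ⟨p, hpm, by simpa using h⟩
      simp [h0] at this
    · have := intervalIntegral.integral_pos zero_lt_one hD (fun x hx => by
        by_cases hxp : x = p
        · rw [hxp]; exact h.le
        · rw [hz x (Ioc_subset_Icc_self hx) hxp]) ⟨p, hpm, h⟩
      exact this.ne' h0

/-- For the densities `F = f / area f` and `G = g / area g`, the crossing lemma with `D = F - G` and
`s = F + G` gives `∫ F² > ∫ G²`. -/
theorem BelowIsInterval.ratio_lt (hfg : BelowIsInterval f g) (hf : IsProfile f)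
    (hg : IsProfile g) (hne : ∃ x ∈ Icc (0 : ℝ) 1, f x ≠ g x) :
    area (opT g) / area g < area (opT f) / area f := by
  have hκ := hf.area_pos
  have hκ' := hg.area_pos
  have h0 : (0 : ℝ) ∈ Icc (0 : ℝ) 1 := left_mem_Icc.2 zero_le_one
  have h1 : (1 : ℝ) ∈ Icc (0 : ℝ) 1 := right_mem_Icc.2 zero_le_one
  have hpos := integral_pos_of_crossing (D := fun x => f x / area f - g x / area g)
    (s := fun x => f x / area f + g x / area g)
    ((hf.cont.div_const _).sub (hg.cont.div_const _))
    ((hf.cont.div_const _).add (hg.cont.div_const _))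
    (fun a ha b hb hab => add_lt_add (div_lt_div_of_pos_right (hf.anti ha hb hab) hκ)
      (div_lt_div_of_pos_right (hg.anti ha hb hab) hκ'))
    (by
      intro x y hx hxy hy hD
      have hl : 0 < area f / area g := div_pos hκ hκ'
      have e : ∀ t, area f / area g * g t = g t / area g * area f := fun t => by ring
      have := hfg.le_of_lt hf hg hl hx hxy hy (by
        rw [e, ← div_lt_iff₀ hκ]
        linarith)
      rw [e, ← div_le_iff₀ hκ] at this
      linarith)
    (by
      rw [intervalIntegral.integral_sub ((hf.intervalIntegrable h0 h1).div_const _)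
        ((hg.intervalIntegrable h0 h1).div_const _), intervalIntegral.integral_div,
        intervalIntegral.integral_div]
      change area f / area f - area g / area g = 0
      rw [div_self hκ.ne', div_self hκ'.ne', sub_self])
    (by
      by_contra! hall
      have e0 := hall 0 h0
      have hκκ : area f = area g := by simpa [hf.zero, hg.zero, sub_eq_zero] using e0
      obtain ⟨x, hx, hxne⟩ := hne
      have ex := hall x hx
      rw [hκκ, sub_eq_zero, div_left_inj' hκ'.ne'] at ex
      exact hxne ex)
  have e : ∀ x, (f x / area f - g x / area g) * (f x / area f + g x / area g)
      = f x ^ 2 / area f ^ 2 - g x ^ 2 / area g ^ 2 := fun x => by ring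
  simp only [e] at hpos
  have hi : ∀ {k : ℝ → ℝ}, IsProfile k → IntervalIntegrable (fun x => k x ^ 2) volume 0 1 :=
    fun hk => ContinuousOn.intervalIntegrable
      (by rw [uIcc_of_le zero_le_one]; exact hk.cont.pow 2)
  rw [intervalIntegral.integral_sub ((hi hf).div_const _) ((hi hg).div_const _),
    intervalIntegral.integral_div, intervalIntegral.integral_div] at hpos
  have e1 := hf.area_opT_mul_area
  have e2 := hg.area_opT_mul_area
  have r1 : area (opT f) / area f
      = (∫ s in (0 : ℝ)..1, f s ^ 2) / area f ^ 2 / 2 := by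
    field_simp
    linarith
  have r2 : area (opT g) / area g
      = (∫ s in (0 : ℝ)..1, g s ^ 2) / area g ^ 2 / 2 := by
    field_simp
    linarith
  rw [r1, r2]
  linarith

/-- The operator `T` is injective on profiles. -/
theorem IsProfile.eqOn_of_opT_eqOn (hf : IsProfile f) (hg : IsProfile g)
    (h : EqOn (opT f) (opT g) (Icc 0 1)) : EqOn f g (Icc 0 1) := by
  have hF := hf.isProfile_pseudoInv
  have hG := hg.isProfile_pseudoInv
  have h0 : (0 : ℝ) ∈ Icc (0 : ℝ) 1 := left_mem_Icc.2 zero_le_one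
  have h1 : (1 : ℝ) ∈ Icc (0 : ℝ) 1 := right_mem_Icc.2 zero_le_one
  have hd : ∀ {k : ℝ → ℝ}, IsProfile k → ∀ x ∈ Ioo (0 : ℝ) 1,
      HasDerivAt (opT k) (-pseudoInv k x / area k) x := by
    intro k hk x hx
    have hK := hk.isProfile_pseudoInv
    apply HasDerivAt.div_const
    have hc := hK.cont.mono Ioo_subset_Icc_self
    exact intervalIntegral.integral_hasDerivAt_left
      (hK.intervalIntegrable (Ioo_subset_Icc_self hx) h1)
      (hc.stronglyMeasurableAtFilter isOpen_Ioo x hx) (hc.continuousAt (isOpen_Ioo.mem_nhds hx))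
  -- Derivatives are compared in the open interval, then extended by continuity; at 0, where both
  -- inverses equal 1, this recovers the area.
  have hE : EqOn (fun x => -pseudoInv f x / area f) (fun x => -pseudoInv g x / area g)
      (Icc 0 1) := by
    refine EqOn.of_subset_closure (s := Ioo 0 1) ?_ (hF.cont.neg.div_const _)
      (hG.cont.neg.div_const _) Ioo_subset_Icc_self (closure_Ioo zero_ne_one).ge
    intro x hx
    refine (hd hf x hx).unique ((hd hg x hx).congr_of_eventuallyEq ?_)
    exact Filter.eventuallyEq_of_mem (Icc_mem_nhds hx.1 hx.2) h
  have hκ : area f = area g := by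
    have := hE h0
    simpa [hF.zero, hG.zero, neg_div] using this
  intro x hx
  have hx' := hf.mem hx
  have := hE hx'
  simp only [hκ, div_left_inj' hg.area_pos.ne', neg_inj, hf.pseudoInv_apply hx] at this
  conv_rhs => rw [this]
  exact (hg.apply_pseudoInv hx').symm

end

/-! ### The iterates `h n` and their areas -/

theorem h_succ (n : ℕ) : h (n + 1) = opT (h n) :=
  Function.iterate_succ_apply' _ _ _

theorem kappa_zero : kappa 0 = 1 := by simp [kappa, area, h]

theorem h_one_apply {x : ℝ} (hx : x ∈ Icc (0 : ℝ) 1) : h 1 x = 1 - x := by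
  have h0 : area (fun _ => 1) = 1 := by simp [area]
  change (∫ t in x..1, pseudoInv (fun _ => 1) t) / area (fun _ => 1) = 1 - x
  rw [h0, div_one, intervalIntegral.integral_congr (g := fun _ => 1)]
  · simp
  · intro t ht
    rw [uIcc_of_le hx.2] at ht
    have : {x : ℝ | x ∈ Icc (0 : ℝ) 1 ∧ t ≤ 1} = Icc 0 1 := by
      ext x
      simp [ht.2]
    rw [pseudoInv, this, csSup_Icc zero_le_one]

theorem isProfile_h_one : IsProfile (h 1) where
  cont := (by fun_prop : ContinuousOn (fun x : ℝ => 1 - x) (Icc 0 1)).congr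
    fun _ hx => h_one_apply hx
  anti := fun a ha b hb hab => by
    rw [h_one_apply ha, h_one_apply hb]
    linarith
  zero := by rw [h_one_apply (left_mem_Icc.2 zero_le_one), sub_zero]
  one := by rw [h_one_apply (right_mem_Icc.2 zero_le_one), sub_self]

theorem isProfile_h (n : ℕ) : IsProfile (h (n + 1)) := by
  induction n with
  | zero => exact isProfile_h_one
  | succ n ih =>
    rw [h_succ]
    exact ih.isProfile_opT

theorem h_mem_classE (n : ℕ) : h n ∈ classE := by
  cases n with
  | zero =>
    refine ⟨fun _ _ => zero_le_one, measurable_const, fun _ _ _ _ _ => le_rfl, rfl, ?_⟩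
    change 0 < kappa 0
    rw [kappa_zero]
    exact zero_lt_one
  | succ n => exact (isProfile_h n).mem_classE

theorem kappa_pos (n : ℕ) : 0 < kappa n := (h_mem_classE n).2.2.2.2

theorem kappa_le_one (n : ℕ) : kappa n ≤ 1 := by
  cases n with
  | zero => exact kappa_zero.le
  | succ n => exact (isProfile_h n).area_le_one

theorem kappa_one : kappa 1 = 1 / 2 := by
  rw [kappa, area, intervalIntegral.integral_congr (g := fun x => 1 - x)]
  · rw [intervalIntegral.integral_sub intervalIntegrable_const
      intervalIntegral.intervalIntegrable_id]
    norm_num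
  · intro x hx
    rw [uIcc_of_le zero_le_one] at hx
    exact h_one_apply hx

theorem pseudoInv_h_one {x : ℝ} (hx : x ∈ Icc (0 : ℝ) 1) : pseudoInv (h 1) x = 1 - x := by
  have hx' : 1 - x ∈ Icc (0 : ℝ) 1 := ⟨by linarith [hx.2], by linarith [hx.1]⟩
  have := isProfile_h_one.pseudoInv_apply hx'
  rwa [h_one_apply hx', sub_sub_cancel] at this

theorem h_two_apply {x : ℝ} (hx : x ∈ Icc (0 : ℝ) 1) : h 2 x = (1 - x) ^ 2 := by
  change opT (h 1) x = _
  have hk : area (h 1) = 1 / 2 := kappa_one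
  rw [opT, hk, intervalIntegral.integral_congr (g := fun t => 1 - t)]
  · rw [intervalIntegral.integral_sub intervalIntegrable_const
      intervalIntegral.intervalIntegrable_id, integral_id, intervalIntegral.integral_const,
      smul_eq_mul]
    ring
  · intro t ht
    rw [uIcc_of_le hx.2] at ht
    exact pseudoInv_h_one ⟨hx.1.trans ht.1, ht.2⟩

theorem kappa_two : kappa 2 = 1 / 3 := by
  rw [kappa, area, intervalIntegral.integral_congr (g := fun x => (1 - x) ^ 2),
    intervalIntegral.integral_comp_sub_left (fun x => x ^ 2)]
  · norm_num
  · intro x hx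
    rw [uIcc_of_le zero_le_one] at hx
    exact h_two_apply hx

theorem belowIsInterval_h_two : BelowIsInterval (h 2) (h 1) := by
  intro l m x y z hl hm hx hxy hyz hz hmz h1 h2
  have hdom : ∀ t, 0 ≤ t → t ≤ z → t ∈ Icc (0 : ℝ) 1 ∧ m * t ∈ Icc (0 : ℝ) 1 := fun t h0 ht =>
    ⟨⟨h0, ht.trans hz⟩, mul_nonneg hm.le h0, (mul_le_mul_of_nonneg_left ht hm.le).trans hmz⟩
  obtain ⟨hx1, hx2⟩ := hdom x hx (by linarith)
  obtain ⟨hy1, hy2⟩ := hdom y (by linarith) hyz.le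
  obtain ⟨hz1, hz2⟩ := hdom z (by linarith) le_rfl
  rw [h_two_apply hx1, h_one_apply hx2] at h1
  rw [h_two_apply hy1, h_one_apply hy2] at h2
  rw [h_two_apply hz1, h_one_apply hz2]
  by_contra! h3
  have hxy' := sub_pos.2 hxy
  have hyz' := sub_pos.2 hyz
  -- Three-point convexity: the sum of `p1`, `p2`, `p3` bounds minus the second difference of `(1 -
  -- x)²`, an exact negative multiple of `p4`; affine terms cancel.
  have p1 := mul_pos hyz' (sub_pos.2 h1)
  have p2 := mul_pos (add_pos hxy' hyz') (sub_pos.2 h2)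
  have p3 := mul_pos hxy' (sub_pos.2 h3)
  have p4 := mul_pos (mul_pos hxy' hyz') (add_pos hxy' hyz')
  linarith

theorem belowIsInterval_h (n : ℕ) : BelowIsInterval (h (n + 2)) (h (n + 1)) := by
  induction n with
  | zero => exact belowIsInterval_h_two
  | succ n ih =>
    have := ih.map_opT (isProfile_h (n + 1)) (isProfile_h n)
    rwa [← h_succ, ← h_succ] at this

theorem exists_h_ne (n : ℕ) : ∃ x ∈ Icc (0 : ℝ) 1, h (n + 2) x ≠ h (n + 1) x := by
  induction n with
  | zero =>
    have hm : (1 / 2 : ℝ) ∈ Icc (0 : ℝ) 1 := by norm_num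
    refine ⟨1 / 2, hm, ?_⟩
    rw [zero_add, zero_add, h_two_apply hm, h_one_apply hm]
    norm_num
  | succ n ih =>
    by_contra! hall
    obtain ⟨x, hx, hne⟩ := ih
    have hT : EqOn (opT (h (n + 2))) (opT (h (n + 1))) (Icc 0 1) := by
      rw [← h_succ, ← h_succ]
      exact hall
    exact hne ((isProfile_h (n + 1)).eqOn_of_opT_eqOn (isProfile_h n) hT hx)

theorem strictMono_ratio : StrictMono (fun n : ℕ => kappa (n + 1) / kappa n) := by
  apply strictMono_nat_of_lt_succ
  intro n
  cases n with
  -- `h 0` is constant, hence not a profile, so `1/2 < 2/3` is checked directly.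
  | zero =>
    simp only [zero_add, Nat.reduceAdd, kappa_zero, kappa_one, kappa_two]
    norm_num
  | succ n =>
    have := (belowIsInterval_h n).ratio_lt (isProfile_h (n + 1)) (isProfile_h n) (exists_h_ne n)
    rwa [← h_succ, ← h_succ] at this

/-! ### Monotonicity, lower bound and limit -/

/-- One ratio at least 1 would make all later ratios at least some `q > 1`, and the areas would
outgrow their bound 1. -/
theorem kappa_succ_lt (n : ℕ) : kappa (n + 1) < kappa n := by
  by_contra! hle
  have hr : 1 ≤ kappa (n + 1) / kappa n := by rwa [one_le_div (kappa_pos n)]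
  set q := kappa (n + 1 + 1) / kappa (n + 1) with hq
  have hq1 : 1 < q := hr.trans_lt (strictMono_ratio n.lt_succ_self)
  have hgrow : ∀ k, q ^ k * kappa (n + 1) ≤ kappa (n + 1 + k) := by
    intro k
    induction k with
    | zero => simp
    | succ k ih =>
      have h1 : q ≤ kappa (n + 1 + k + 1) / kappa (n + 1 + k) :=
        strictMono_ratio.monotone (Nat.le_add_right (n + 1) k)
      rw [le_div_iff₀ (kappa_pos _)] at h1
      calc q ^ (k + 1) * kappa (n + 1) = q * (q ^ k * kappa (n + 1)) := by ring
        _ ≤ q * kappa (n + 1 + k) := by gcongr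
        _ ≤ _ := h1
  obtain ⟨k, hk⟩ := pow_unbounded_of_one_lt (kappa (n + 1))⁻¹ hq1
  rw [inv_lt_iff_one_lt_mul₀ (kappa_pos _)] at hk
  linarith [hgrow k, kappa_le_one (n + 1 + k), mul_comm (kappa (n + 1)) (q ^ k)]

/-- The inverse is at most 1, so `opT f` falls with slope at most `1 / area f` and stays above `1/2`
on `[0, area f / 2]`. -/
theorem IsProfile.area_le_integral_opT_sq {f : ℝ → ℝ} (hf : IsProfile f) :
    area f / 8 ≤ ∫ x in (0 : ℝ)..1, opT f x ^ 2 := by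
  have hT := hf.isProfile_opT
  have hκ := hf.area_pos
  have hκ1 := hf.area_le_one
  have h0 : (0 : ℝ) ∈ Icc (0 : ℝ) 1 := left_mem_Icc.2 zero_le_one
  have hc : area f / 2 ∈ Icc (0 : ℝ) 1 := ⟨by linarith, by linarith⟩
  have hi : ∀ {a b : ℝ}, a ∈ Icc (0 : ℝ) 1 → b ∈ Icc (0 : ℝ) 1 →
      IntervalIntegrable (fun x => opT f x ^ 2) volume a b := fun ha hb =>
    ((hT.cont.pow 2).mono (uIcc_subset_Icc ha hb)).intervalIntegrable
  have hlow : ∀ x ∈ Icc (0 : ℝ) (area f / 2), 1 / 4 ≤ opT f x ^ 2 := by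
    intro x hx
    have hx' : x ∈ Icc (0 : ℝ) 1 := ⟨hx.1, hx.2.trans hc.2⟩
    have e := hf.opT_sub h0 hx'
    have hle := intervalIntegral.integral_mono_on hx.1
      (hf.isProfile_pseudoInv.intervalIntegrable h0 hx') (intervalIntegrable_const (c := (1 : ℝ)))
      (fun t ht => (hf.pseudoInv_mem ⟨ht.1, ht.2.trans hx'.2⟩).2)
    rw [intervalIntegral.integral_const, sub_zero, smul_eq_mul, mul_one] at hle
    have hq : (∫ t in (0 : ℝ)..x, pseudoInv f t) / area f ≤ 1 / 2 := by
      rw [div_le_iff₀ hκ]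
      linarith [hx.2]
    rw [hT.zero] at e
    nlinarith
  have h1 := intervalIntegral.integral_mono_on hc.1 (intervalIntegrable_const (c := (1 / 4 : ℝ)))
    (hi h0 hc) hlow
  have h2 := intervalIntegral.integral_nonneg (μ := volume) hc.2
    (fun x _ => sq_nonneg (opT f x))
  rw [← intervalIntegral.integral_add_adjacent_intervals (hi h0 hc)
    (hi hc (right_mem_Icc.2 zero_le_one))]
  rw [intervalIntegral.integral_const, sub_zero, smul_eq_mul] at h1
  linarith

theorem one_div_sixteen_le_kappa (n : ℕ) : 1 / 16 ≤ kappa n := by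
  have hanti : StrictAnti kappa := strictAnti_nat_of_succ_lt kappa_succ_lt
  refine le_trans ?_ (hanti.antitone (by omega : n ≤ n + 3))
  have h1 := (isProfile_h n).area_le_integral_opT_sq
  have h2 := (isProfile_h (n + 1)).area_opT_mul_area
  rw [← h_succ] at h1 h2
  have h3 : kappa (n + 2) < kappa (n + 1) := kappa_succ_lt (n + 1)
  have h4 := kappa_pos (n + 3)
  have h5 := kappa_pos (n + 1)
  -- Half of the `1/8` bound on `∫ (h (n+2))²`; dividing by `kappa (n + 2) < kappa (n + 1)` leaves
  -- `1/16`.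
  have h6 : kappa (n + 1) / 16 ≤ kappa (n + 3) * kappa (n + 2) := by
    simp only [kappa]
    linarith
  by_contra! hlt
  nlinarith

theorem tendsto_ratio :
    Filter.Tendsto (fun n : ℕ => kappa (n + 1) / kappa n) Filter.atTop (nhds 1) := by
  have hanti : StrictAnti kappa := strictAnti_nat_of_succ_lt kappa_succ_lt
  have hbdd : BddBelow (range kappa) := ⟨0, by rintro _ ⟨n, rfl⟩; exact (kappa_pos n).le⟩
  have hL := tendsto_atTop_ciInf hanti.antitone hbdd
  have hpos : (0 : ℝ) < ⨅ n, kappa n :=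
    lt_of_lt_of_le (by norm_num) (le_ciInf one_div_sixteen_le_kappa)
  have := (hL.comp (Filter.tendsto_add_atTop_nat 1)).div hL hpos.ne'
  rwa [div_self hpos.ne'] at this

end Stribola

theorem mainTheorem8 :
    (∀ n : ℕ, Stribola.h n ∈ Stribola.classE) ∧
    (∀ n : ℕ, 1 ≤ n →
      Stribola.kappa n ^ 2 < Stribola.kappa (n - 1) * Stribola.kappa (n + 1)) ∧
    StrictMono (fun n : ℕ => Stribola.kappa (n + 1) / Stribola.kappa n) ∧
    Filter.Tendsto (fun n : ℕ => Stribola.kappa (n + 1) / Stribola.kappa n)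
      Filter.atTop (nhds 1) := by
  refine ⟨Stribola.h_mem_classE, ?_, Stribola.strictMono_ratio, Stribola.tendsto_ratio⟩
  intro n hn
  obtain ⟨k, rfl⟩ := Nat.exists_eq_add_of_le' hn
  have := Stribola.strictMono_ratio k.lt_succ_self
  simp only [Nat.succ_eq_add_one] at this
  rw [div_lt_div_iff₀ (Stribola.kappa_pos _) (Stribola.kappa_pos _)] at this
  rw [Nat.add_sub_cancel]
  linarith
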